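/- Let $k$ be a field of characteristic zero and let $H$ be a commutative Hopf algebra over $k$ which is connected graded as an algebra, i.e. a decomposition $H=\bigoplus_{n\ge 0}H_n$ into $k$-subspaces is given with $H_0=k\cdot 1_H$ and $H_iH_j\subseteq H_{i+j}$ for all $i,j\ge 0$ (the comultiplication, counit and antipode are not required to respect the grading). Let $K\subseteq H$ be a Hopf subalgebra (a subalgebra with $\Delta(K)\subseteq K\otimes K$ and $S(K)\subseteq K$) which is also a graded subalgebra, i.e. $K=\bigoplus_{n\ge 0}K_n$ with $K_n=K\cap H_n$. Put $H_+=\bigoplus_{n\ge 1}H_n$ and $K_+=\bigoplus_{n\ge 1}K_n$, and let $(H_+)^2$ and $(K_+)^2$ denote the $k$-linear spans of all products of two elements of $H_+$ and of $K_+$, respectively. If $(H_+)^2\cap K=(K_+)^2$, then $H$ is isomorphic as a graded algebra to the graded polynomial algebra over $K$ in some family of graded variables: there are a set $\Gamma$, positive integers $(w_\gamma)_{\gamma\in\Gamma}$ and an isomorphism of $K$-algebras $K[x_\gamma : \gamma\in\Gamma]\to H$ which for every $n\ge 0$ maps the degree $n$ component of $K[x_\gamma:\gamma\in\Gamma]$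 onto $H_n$, where $x_\gamma$ has degree $w_\gamma$ and $K$ carries its grading $(K_n)_{n\geq 0}$. -/

import Mathlib

universe u v

/-- `K` is a Hopf subalgebra of the Hopf algebra `H`: a subalgebra with `Δ(K) ⊆ K ⊗ K` and
`S(K) ⊆ K`. Over a field the map `K ⊗ K → H ⊗ H` is injective, so `K ⊗ K` is identified with its
image, the range of `TensorProduct.mapIncl`. -/
structure Subalgebra.IsHopfSubalgebra {k H : Type*} [Field k] [Ring H] [HopfAlgebra k H]
    (K : Subalgebra k H) : Prop where
  comul_mem : ∀ x ∈ K, Coalgebra.comul (R := k) x ∈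
    LinearMap.range (TensorProduct.mapIncl (Subalgebra.toSubmodule K) (Subalgebra.toSubmodule K))
  antipode_mem : ∀ x ∈ K, HopfAlgebra.antipode k x ∈ K

/-- The degree `n` component `K_n = K ∩ H_n` of a subalgebra `K` of a graded algebra. -/
def Subalgebra.gradedPiece {k H : Type*} [Field k] [Ring H] [Algebra k H]
    (K : Subalgebra k H) (𝒜 : ℕ → Submodule k H) (n : ℕ) : Submodule k H :=
  Subalgebra.toSubmodule K ⊓ 𝒜 n

/-- `V_+ = ∑_{n ≥ 1} V_n` for a family of subspaces `V_n` of `H`. -/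
def positivePart {k H : Type*} [Field k] [Ring H] [Algebra k H]
    (V : ℕ → Submodule k H) : Submodule k H :=
  ⨆ n : ℕ, V (n + 1)

/-- The degree `n` component of the graded polynomial algebra `K[x_i : i ∈ σ]` over the graded
subalgebra `K`, where the variable `x_i` has degree `w i`: the `k`-subspace of the polynomials in
which each monomial `x^d` that occurs has a homogeneous coefficient of degree `m` in `K`
with `m + ∑ i, d i * w i = n`. -/
def Subalgebra.polynomialPiece {k H : Type*} [Field k] [CommRing H] [Algebra k H]
    (K : Subalgebra k H) (𝒜 : ℕ → Submodule k H) {σ : Type*} (w : σ → ℕ) (n : ℕ) :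
    Submodule k (MvPolynomial σ K) where
  carrier := {p | ∀ d : σ →₀ ℕ, MvPolynomial.coeff d p = 0 ∨
    ∃ m : ℕ, m + Finsupp.weight w d = n ∧ ((MvPolynomial.coeff d p : K) : H) ∈ K.gradedPiece 𝒜 m}
  zero_mem' := fun _ => Or.inl (MvPolynomial.coeff_zero _)
  add_mem' := by
    intro p q hp hq d
    rcases hp d with h | ⟨m, hm, h⟩
    · simpa [h] using hq d
    · rcases hq d with h' | ⟨m', hm', h'⟩
      · exact Or.inr ⟨m, hm, by simpa [h'] using h⟩
      · obtain rfl : m = m' := by omega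
        exact Or.inr ⟨m, hm, by simpa using add_mem h h'⟩
  smul_mem' := by
    intro c p hp d
    rcases hp d with h | ⟨m, hm, h⟩
    · exact Or.inl (by simp [h])
    · exact Or.inr ⟨m, hm, by simpa using Submodule.smul_mem _ c h⟩

/-! Lift a basis of H_+/(H_+)² to homogeneous elements x_i, with the x_i for i in S lying in K and
spanning the image of K_+. By graded Nakayama the x_i generate H. Since (H_+)² ∩ K = (K_+)², the
same induction shows that those in S generate K. It remains to see that the x_i are algebraically
independent over k: the others are then independent over K = k[x_S].

The dual functionals δ_i are point derivations at the character α that kills H_+. The Hopf structure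
extends them to derivations D_i of H (`HopfAlgebra.exists_derivation_of_pointDerivation`). These
carry relations to relations and agree with ∂/∂x_i modulo the augmentation ideal, so in
characteristic zero a relation vanishes to every order at the origin
(`algebraicIndependent_of_dual_derivations`). -/

/-! ### Derivations on commutative Hopf algebras. -/

open TensorProduct WithConv in
/-- On a commutative Hopf algebra, every derivation at a character `α` extends to a derivation of
the whole algebra: it is the composite of a translate of an invariant derivation with `α`. -/
theorem HopfAlgebra.exists_derivation_of_pointDerivation {k H : Type*} [Field k] [CommRing H]
    [HopfAlgebra k H] (α : H →ₐ[k] k) (δ : H →ₗ[k] k)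
    (hδ : ∀ a b, δ (a * b) = α a * δ b + δ a * α b) :
    ∃ D : Derivation k H H, ∀ a, α (D a) = δ a := by
  -- In Sweedler notation φ(a) = a₁ α(S a₂), so that α ∘ φ = ε, and D(a) = φ(a₁) δ(a₂).
  let g : WithConv (H →ₐ[k] H) := toConv ((Algebra.ofId k H).comp α)
  let φ : WithConv (H →ₐ[k] H) := toConv (AlgHom.id k H) * g⁻¹
  have hφg : φ * g = toConv (AlgHom.id k H) := by simp [φ]
  have hαφ : α.comp φ.ofConv = (Algebra.ofId k k).comp (Bialgebra.counitAlgHom k H) := by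
    let u : WithConv (H →ₐ[k] k) := toConv α
    have h1 : α.comp φ.ofConv = (u * u⁻¹).ofConv := by
      rw [AlgHom.comp_convMul_distrib]
      congr 2
      ext x
      change α (algebraMap k H (α (HopfAlgebra.antipode k x))) = α (HopfAlgebra.antipode k x)
      simp
    rw [h1, mul_inv_cancel]
    rfl
  let M : H ⊗[k] H →ₐ[k] H :=
    Algebra.TensorProduct.lift φ.ofConv g.ofConv (fun _ _ => .all _ _)
  have hM : ∀ a, M (Coalgebra.comul a) = a := fun a => by
    rw [← AlgHom.convMul_apply, hφg]; rfl
  let L : H ⊗[k] H →ₗ[k] H :=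
    TensorProduct.lift ((LinearMap.mul k H).compl₁₂ φ.ofConv.toLinearMap
      ((Algebra.linearMap k H).comp δ))
  have hMt : ∀ a b, M (a ⊗ₜ b) = φ.ofConv a * algebraMap k H (α b) := fun a b => rfl
  have hLt : ∀ a b, L (a ⊗ₜ b) = φ.ofConv a * algebraMap k H (δ b) := fun a b => rfl
  have hL : ∀ u v, L (u * v) = M u * L v + M v * L u := by
    intro u v
    induction u with
    | zero => simp
    | add x y hx hy => rw [add_mul, map_add, hx, hy, map_add, map_add]; ring
    | tmul a b =>
      induction v with
      | zero => simp
      | add x y hx hy => rw [mul_add, map_add, hx, hy, map_add, map_add]; ring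
      | tmul c d =>
        rw [Algebra.TensorProduct.tmul_mul_tmul, hLt, hLt, hLt, hMt, hMt, hδ]
        simp only [map_mul, map_add]
        ring
  refine ⟨Derivation.mk' (L.comp Coalgebra.comul) fun a b => ?_, fun a => ?_⟩
  · simp only [LinearMap.comp_apply, Bialgebra.comul_mul, hL, hM, smul_eq_mul]
  · change α (L (Coalgebra.comul a)) = δ a
    have h2 : α.toLinearMap.comp L =
        δ.comp ((TensorProduct.lid k H).toLinearMap.comp
          (LinearMap.rTensor H (Coalgebra.counit (R := k) (A := H)))) := by
      ext a b
      have := DFunLike.congr_fun hαφ a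
      simp only [AlgHom.comp_apply] at this
      simp [hLt, this]
    have h3 := LinearMap.congr_fun h2 (Coalgebra.comul a)
    simp only [LinearMap.comp_apply, Coalgebra.rTensor_counit_comul] at h3
    simpa using h3

/-! ### Algebraic independence from dual derivations. -/

namespace MvPolynomial

/-- In characteristic zero, a polynomial without constant term all of whose partial derivatives
vanish to order `n` at the origin vanishes to order `n + 1` there. -/
theorem mem_idealOfVars_pow_succ_of_pderiv_mem {ι k : Type*} [Field k] [CharZero k]
    {f : MvPolynomial ι k} {n : ℕ} (h0 : constantCoeff f = 0)
    (h : ∀ i, pderiv i f ∈ idealOfVars ι k ^ n) : f ∈ idealOfVars ι k ^ (n + 1) := by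
  rw [mem_pow_idealOfVars_iff']
  intro d hd
  by_cases hd0 : d = 0
  · subst hd0; exact h0
  obtain ⟨i, hi⟩ : d.support.Nonempty := Finsupp.support_nonempty_iff.mpr hd0
  obtain ⟨c, rfl⟩ : ∃ c, d = c + Finsupp.single i 1 := by
    refine ⟨d - Finsupp.single i 1, (tsub_add_cancel_of_le ?_).symm⟩
    simpa [Finsupp.single_le_iff, Nat.one_le_iff_ne_zero] using hi
  have h1 := (mem_pow_idealOfVars_iff' n _).mp (h i) c (by
    rw [map_add, Finsupp.degree_single] at hd; omega)
  rw [coeff_pderiv] at h1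
  exact (mul_eq_zero.mp h1).resolve_right (by exact_mod_cast Nat.succ_ne_zero (c i))

theorem mem_idealOfVars_iff_constantCoeff {ι k : Type*} [Field k] {f : MvPolynomial ι k} :
    f ∈ idealOfVars ι k ↔ constantCoeff f = 0 := by
  rw [← pow_one (idealOfVars ι k), mem_pow_idealOfVars_iff']
  constructor
  · intro h; exact h 0 (by simp)
  · intro h d hd
    obtain rfl : d = 0 := (Finsupp.degree_eq_zero_iff d).mp (by omega)
    exact h

end MvPolynomial

/-- A derivation that maps a ring into an ideal preserves the powers of that ideal. -/
theorem Derivation.mem_pow_of_forall_mem {k R : Type*} [CommRing k] [CommRing R] [Algebra k R]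
    (E : Derivation k R R) {J : Ideal R} (hE : ∀ a, E a ∈ J) (n : ℕ) {a : R} (ha : a ∈ J ^ n) :
    E a ∈ J ^ n := by
  induction n generalizing a with
  | zero => simp
  | succ n ih =>
    rw [pow_succ] at ha ⊢
    induction ha using Submodule.mul_induction_on' with
    | mem_mul_mem x hx y hy =>
      rw [E.leibniz, smul_eq_mul, smul_eq_mul, mul_comm y]
      exact add_mem (Ideal.mul_mem_mul hx (hE y)) (Ideal.mul_mem_mul (ih hx) hy)
    | add x _ y _ hx hy => rw [map_add]; exact add_mem hx hy

open MvPolynomial in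
/-- A generating family of an augmented algebra in characteristic zero is algebraically
independent if it admits derivations that are dual to it at the augmentation. -/
theorem algebraicIndependent_of_dual_derivations {ι k H : Type*} [Field k] [CharZero k]
    [CommRing H] [Algebra k H] (α : H →ₐ[k] k) (x : ι → H) (hα : ∀ i, α (x i) = 0)
    (hsurj : Function.Surjective (aeval x : MvPolynomial ι k →ₐ[k] H))
    (D : ι → Derivation k H H) (hself : ∀ i, α (D i (x i)) = 1)
    (hne : ∀ i j, i ≠ j → α (D i (x j)) = 0) : AlgebraicIndependent k x := by
  classical
  let J : Ideal (MvPolynomial ι k) := idealOfVars ι k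
  have hcc : ∀ f : MvPolynomial ι k, α (aeval x f) = constantCoeff f := by
    have : α.comp (aeval x) = (aeval (0 : ι → k)) := by ext i; simp [hα]
    intro f
    rw [← AlgHom.comp_apply, this, aeval_zero]; rfl
  choose p hp using fun i j => hsurj (D i (x j))
  -- `T i` lifts `D i` along `aeval x`, hence preserves the relations.
  let T : ι → Derivation k (MvPolynomial ι k) (MvPolynomial ι k) := fun i => mkDerivation k (p i)
  have hT : ∀ i f, aeval x (T i f) = D i (aeval x f) := by
    intro i f
    induction f using MvPolynomial.induction_on with
    | C a => simp
    | add f g hf hg => simp [hf, hg]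
    | mul_X f j hf => simp [hf, T, mkDerivation_X, hp]
  have hE : ∀ i (f : MvPolynomial ι k), (T i - pderiv i : Derivation k _ _) f ∈ J := by
    intro i f
    induction f using MvPolynomial.induction_on with
    | C a => simp
    | add f g hf hg => rw [map_add]; exact add_mem hf hg
    | mul_X f j hf =>
      rw [Derivation.leibniz, smul_eq_mul, smul_eq_mul]
      refine add_mem (Ideal.mul_mem_left _ _ ?_) (Ideal.mul_mem_left _ _ hf)
      rw [mem_idealOfVars_iff_constantCoeff, Derivation.sub_apply, map_sub, mkDerivation_X,
        ← hcc, hp, pderiv_X]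
      rcases eq_or_ne i j with rfl | hij
      · simp [hself]
      · simp [hne i j hij, Pi.single_eq_of_ne (Ne.symm hij)]
  -- For a relation f in J^n, both `T i f` and `(T i - pderiv i) f` lie in J^n, hence so does
  -- `pderiv i f`.
  have key : ∀ n, ∀ f : MvPolynomial ι k, aeval x f = 0 → f ∈ J ^ n := by
    intro n
    induction n with
    | zero => simp
    | succ n ih =>
      intro f hf
      refine mem_idealOfVars_pow_succ_of_pderiv_mem (by rw [← hcc, hf, map_zero]) fun i => ?_
      have h1 : T i f ∈ J ^ n := ih _ (by rw [hT, hf, map_zero])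
      have h2 := (T i - pderiv i : Derivation k _ _).mem_pow_of_forall_mem (hE i) n (ih f hf)
      have := sub_mem h1 h2
      simpa using this
  rw [algebraicIndependent_iff]
  intro f hf
  ext d
  exact (mem_pow_idealOfVars_iff' _ _).mp (key (d.degree + 1) f hf) d (Nat.lt_succ_self _)

/-! ### Adapted generators and graded algebras. -/

/-- Given `U ≤ A` and `Q`, there is a family in `A` inducing a basis of the image of `A` modulo `Q`,
part of which lies in `U` and induces a basis of the image of `U`; it comes with dual functionals
that vanish on `Q`. -/
theorem Submodule.exists_adapted_family {k : Type u} {V : Type v} [Field k] [AddCommGroup V]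
    [Module k V] {U A : Submodule k V} (hUA : U ≤ A) (Q : Submodule k V) :
    ∃ (J : Type v) (y : J → V) (S : Set J) (f : J → V →ₗ[k] k),
      (∀ j, y j ∈ A) ∧ (∀ j ∈ S, y j ∈ U) ∧ (∀ j, ∀ q ∈ Q, f j q = 0) ∧
      (∀ j, f j (y j) = 1) ∧ (∀ i j, i ≠ j → f i (y j) = 0) ∧
      A ≤ span k (Set.range y) ⊔ Q ∧ U ≤ span k (y '' S) ⊔ Q := by
  obtain ⟨s, hsU, hsspan, hsli⟩ := exists_linearIndependent k (Q.mkQ '' (U : Set V))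
  obtain ⟨t, htA, hst, htspan, htli⟩ := exists_linearIndepOn_id_extension (K := k)
    (s := s) (t := Q.mkQ '' (A : Set V)) hsli
    (hsU.trans (Set.image_mono hUA))
  have hlift : ∀ j : t, ∃ y : V, Q.mkQ y = j ∧ y ∈ A ∧ ((j : V ⧸ Q) ∈ s → y ∈ U) := by
    rintro ⟨j, hj⟩
    by_cases hjs : j ∈ s
    · obtain ⟨y, hy, rfl⟩ := hsU hjs
      exact ⟨y, rfl, hUA hy, fun _ => hy⟩
    · obtain ⟨y, hy, rfl⟩ := htA hj
      exact ⟨y, rfl, hy, fun h => absurd h hjs⟩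
  choose y hy hyA hyU using hlift
  have hli : LinearIndependent k ((↑) : t → V ⧸ Q) := htli
  obtain ⟨g, hg⟩ := LinearMap.exists_extend hli.repr
  have hgj : ∀ j : t, g j = Finsupp.single j 1 := fun j => by
    rw [← hli.repr_eq_single j ⟨j, subset_span ⟨j, rfl⟩⟩ rfl, ← hg]; rfl
  have hcover : ∀ (B : Submodule k V) (T : Set t),
      (Q.mkQ '' (B : Set V)) ⊆ span k ((↑) '' T : Set (V ⧸ Q)) → B ≤ span k (y '' T) ⊔ Q := by
    intro B T h b hb
    have hb' : Q.mkQ b ∈ (span k (y '' T)).map Q.mkQ := by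
      rw [map_span, ← Set.image_comp]
      have : (Q.mkQ ∘ y) = ((↑) : t → V ⧸ Q) := funext hy
      rw [this]
      exact h ⟨b, hb, rfl⟩
    have := mem_comap.mpr hb'
    rwa [comap_map_eq, ker_mkQ] at this
  refine ⟨t, y, {j | (j : V ⧸ Q) ∈ s}, fun j => (Finsupp.lapply j).comp (g.comp Q.mkQ), hyA,
    fun j hj => hyU j hj, fun j q hq => ?_, fun j => ?_, fun i j hij => ?_, ?_, ?_⟩
  · simp [(Quotient.mk_eq_zero Q).mpr hq]
  · rw [LinearMap.comp_apply, LinearMap.comp_apply, hy, hgj]; simp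
  · rw [LinearMap.comp_apply, LinearMap.comp_apply, hy, hgj]
    simp [Finsupp.single_eq_of_ne hij]
  · rw [← Set.image_univ]
    refine hcover A _ ?_
    rwa [Set.image_univ, Subtype.range_coe]
  · refine hcover U _ ?_
    have : ((↑) '' {j : t | (j : V ⧸ Q) ∈ s} : Set (V ⧸ Q)) = s := by
      ext z; simpa using fun hz => hst hz
    rw [this, hsspan]
    exact subset_span

section Graded

variable {k : Type u} {H : Type v} [Field k] [CommRing H]

section Algebra

variable [Algebra k H] (𝒜 : ℕ → Submodule k H)

theorem mem_positivePart {V : ℕ → Submodule k H} {n : ℕ} (hn : 0 < n) {a : H} (ha : a ∈ V n) :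
    a ∈ positivePart V := by
  obtain ⟨m, rfl⟩ := Nat.exists_eq_succ_of_ne_zero hn.ne'
  exact (le_iSup (fun n => V (n + 1)) m) ha

variable [GradedAlgebra 𝒜]

theorem GradedAlgebra.proj_of_mem {n : ℕ} {a : H} (ha : a ∈ 𝒜 n) :
    GradedAlgebra.proj 𝒜 n a = a := by
  rw [GradedAlgebra.proj_apply, DirectSum.decompose_of_mem_same 𝒜 ha]

theorem GradedAlgebra.proj_of_mem_ne {m n : ℕ} {a : H} (ha : a ∈ 𝒜 m) (h : m ≠ n) :
    GradedAlgebra.proj 𝒜 n a = 0 := by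
  rw [GradedAlgebra.proj_apply, DirectSum.decompose_of_mem_ne 𝒜 ha h]

theorem proj_mem_of_mem_positivePart_mul {W : ℕ → Submodule k H} (hW : ∀ n, W n ≤ 𝒜 n)
    {B : Submodule k H} {n : ℕ}
    (hB : ∀ i j, i + 1 + (j + 1) = n → ∀ a ∈ W (i + 1), ∀ b ∈ W (j + 1), a * b ∈ B) {q : H}
    (hq : q ∈ positivePart W * positivePart W) : GradedAlgebra.proj 𝒜 n q ∈ B := by
  suffices h : positivePart W * positivePart W ≤ B.comap (GradedAlgebra.proj 𝒜 n) from h hq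
  simp only [positivePart, Submodule.iSup_mul, Submodule.mul_iSup, iSup_le_iff, Submodule.mul_le]
  intro j i a ha b hb
  have hab := SetLike.mul_mem_graded (hW _ ha) (hW _ hb)
  rw [Submodule.mem_comap]
  by_cases h : i + 1 + (j + 1) = n
  · rw [GradedAlgebra.proj_of_mem 𝒜 (h ▸ hab)]
    exact hB i j h a ha b hb
  · rw [GradedAlgebra.proj_of_mem_ne 𝒜 hab h]
    exact zero_mem B

/-- Graded Nakayama: the degree n + 1 part of a product of positive elements involves only factors
of degree at most n. -/
theorem le_of_le_sup_positivePart_mul {W : ℕ → Submodule k H} (hW : ∀ n, W n ≤ 𝒜 n)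
    (B : Subalgebra k H) (h0 : W 0 ≤ Subalgebra.toSubmodule B)
    (hsucc : ∀ n, W (n + 1) ≤
      (Subalgebra.toSubmodule B ⊓ 𝒜 (n + 1)) ⊔ positivePart W * positivePart W) (n : ℕ) :
    W n ≤ Subalgebra.toSubmodule B := by
  induction n using Nat.strong_induction_on with
  | _ n ih =>
    cases n with
    | zero => exact h0
    | succ n =>
      intro a ha
      obtain ⟨r, ⟨hrB, hr⟩, q, hq, hrq⟩ := Submodule.mem_sup.mp (hsucc n ha)
      have h1 := congrArg (GradedAlgebra.proj 𝒜 (n + 1)) hrq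
      rw [map_add, GradedAlgebra.proj_of_mem 𝒜 hr, GradedAlgebra.proj_of_mem 𝒜 (hW _ ha)] at h1
      rw [← h1]
      refine add_mem hrB (proj_mem_of_mem_positivePart_mul 𝒜 hW (fun i j hij a ha b hb => ?_) hq)
      exact B.mul_mem (ih _ (by omega) ha) (ih _ (by omega) hb)

/-- A homogeneous family inducing a basis of `H_+ / (H_+)²`, adapted to the image of a graded
subalgebra `K`, with dual functionals vanishing on `1` and on `(H_+)²`. -/
theorem exists_homogeneous_adapted_family (K : Subalgebra k H) :
    ∃ (ι : Type v) (deg : ι → ℕ) (x : ι → H) (S : Set ι) (δ : ι → H →ₗ[k] k),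
      (∀ i, 0 < deg i) ∧ (∀ i, x i ∈ 𝒜 (deg i)) ∧ (∀ i ∈ S, x i ∈ K) ∧ (∀ i, δ i 1 = 0) ∧
      (∀ i, ∀ q ∈ positivePart 𝒜 * positivePart 𝒜, δ i q = 0) ∧ (∀ i, δ i (x i) = 1) ∧
      (∀ i j, i ≠ j → δ i (x j) = 0) ∧
      (∀ n, 𝒜 (n + 1) ≤
        Submodule.span k (x '' {i | deg i = n + 1}) ⊔ positivePart 𝒜 * positivePart 𝒜) ∧
      ∀ n, K.gradedPiece 𝒜 (n + 1) ≤ Submodule.span k (x '' {i | i ∈ S ∧ deg i = n + 1}) ⊔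
        positivePart 𝒜 * positivePart 𝒜 := by
  set Q := positivePart 𝒜 * positivePart 𝒜
  choose J y S f hyA hyU hfQ hself hne hA hU using fun n : ℕ =>
    Submodule.exists_adapted_family (inf_le_right : K.gradedPiece 𝒜 (n + 1) ≤ 𝒜 (n + 1)) Q
  refine ⟨Σ n, J n, fun i => i.1 + 1, fun i => y i.1 i.2, {i | i.2 ∈ S i.1},
    -- Projecting first makes the functional vanish on 1 and on generators of other degrees.
    fun i => (f i.1 i.2).comp (GradedAlgebra.proj 𝒜 (i.1 + 1)), fun i => Nat.succ_pos _,
    fun i => hyA _ _, fun i hi => (hyU _ _ hi).1, fun i => ?_, fun i q hq => ?_, fun i => ?_, ?_,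
    fun n => (hA n).trans (sup_le_sup_right (Submodule.span_mono ?_) _),
    fun n => (hU n).trans (sup_le_sup_right (Submodule.span_mono ?_) _)⟩
  · rw [LinearMap.comp_apply,
      GradedAlgebra.proj_of_mem_ne 𝒜 (SetLike.GradedOne.one_mem (A := 𝒜)) (Nat.succ_ne_zero _).symm,
      map_zero]
  · refine hfQ _ _ _ (proj_mem_of_mem_positivePart_mul 𝒜 (fun _ => le_rfl) ?_ hq)
    intro i j _ a ha b hb
    exact Submodule.mul_mem_mul (mem_positivePart (Nat.succ_pos _) ha)
      (mem_positivePart (Nat.succ_pos _) hb)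
  · rw [LinearMap.comp_apply, GradedAlgebra.proj_of_mem 𝒜 (hyA _ _), hself]
  · rintro ⟨m, i⟩ ⟨n, j⟩ hij
    rw [LinearMap.comp_apply]
    by_cases hmn : n = m
    · subst hmn
      rw [GradedAlgebra.proj_of_mem 𝒜 (hyA _ _)]
      exact hne _ _ _ fun h => hij (Sigma.ext rfl (heq_of_eq h))
    · rw [GradedAlgebra.proj_of_mem_ne 𝒜 (hyA _ _) (by simpa using hmn), map_zero]
  · rintro _ ⟨j, rfl⟩
    exact ⟨⟨n, j⟩, rfl, rfl⟩
  · rintro _ ⟨j, hj, rfl⟩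
    exact ⟨⟨n, j⟩, ⟨hj, rfl⟩, rfl⟩

theorem Subalgebra.toSubmodule_le_of_gradedPiece_le {K : Subalgebra k H}
    (hK : DirectSum.SetLike.IsHomogeneous 𝒜 K) {B : Submodule k H}
    (h : ∀ n, K.gradedPiece 𝒜 n ≤ B) : Subalgebra.toSubmodule K ≤ B := by
  classical
  intro a ha
  rw [← DirectSum.sum_support_decompose 𝒜 a]
  exact sum_mem fun n _ => h n ⟨hK n ha, SetLike.coe_mem _⟩

theorem eq_top_of_graded_le {B : Submodule k H} (h : ∀ n, 𝒜 n ≤ B) : B = ⊤ := by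
  classical
  refine eq_top_iff.mpr fun a _ => ?_
  rw [← DirectSum.sum_support_decompose 𝒜 a]
  exact sum_mem fun n _ => h n (SetLike.coe_mem _)

theorem Subalgebra.map_polynomialPiece {K : Subalgebra k H}
    (hK : DirectSum.SetLike.IsHomogeneous 𝒜 K) {σ : Type*} {w : σ → ℕ} {x : σ → H}
    (hx : ∀ i, x i ∈ 𝒜 (w i))
    (hsurj : Function.Surjective (MvPolynomial.aeval x : MvPolynomial σ K →ₐ[K] H)) (n : ℕ) :
    (K.polynomialPiece 𝒜 w n).map
      (((MvPolynomial.aeval x : MvPolynomial σ K →ₐ[K] H).restrictScalars k).toLinearMap) =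
        𝒜 n := by
  classical
  have hmon : ∀ d : σ →₀ ℕ, (d.prod fun i e => x i ^ e) ∈ 𝒜 (Finsupp.weight w d) := by
    intro d
    rw [Finsupp.weight_apply, Finsupp.sum, Finsupp.prod]
    exact SetLike.prod_pow_mem_graded 𝒜 _ _ _ fun i _ => hx i
  apply le_antisymm
  · rintro _ ⟨p, hp, rfl⟩
    change MvPolynomial.aeval x p ∈ 𝒜 n
    rw [p.as_sum, map_sum]
    refine sum_mem fun d _ => ?_
    rw [MvPolynomial.aeval_monomial]
    rcases hp d with h | ⟨m, rfl, h⟩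
    · rw [h, map_zero, zero_mul]
      exact zero_mem _
    · exact SetLike.mul_mem_graded h.2 (hmon d)
  · intro a ha
    obtain ⟨p, rfl⟩ := hsurj a
    -- With the projection in place, p need not be homogeneous and induction on p applies.
    rw [← GradedAlgebra.proj_of_mem 𝒜 ha]
    clear ha
    induction p using MvPolynomial.induction_on' with
    | add p q hp hq => rw [map_add, map_add]; exact add_mem hp hq
    | monomial d c =>
      rw [MvPolynomial.aeval_monomial, GradedAlgebra.proj_apply]
      by_cases h : Finsupp.weight w d ≤ n
      · rw [DirectSum.coe_decompose_mul_of_right_mem_of_le 𝒜 (hmon d) h]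
        refine ⟨MvPolynomial.monomial d ⟨_, hK (n - Finsupp.weight w d) c.2⟩, fun d' => ?_,
          MvPolynomial.aeval_monomial _ _ _⟩
        rw [MvPolynomial.coeff_monomial]
        split_ifs with hd
        · subst hd
          exact Or.inr ⟨_, Nat.sub_add_cancel h, hK _ c.2, SetLike.coe_mem _⟩
        · exact Or.inl rfl
      · rw [DirectSum.coe_decompose_mul_of_right_mem_of_not_le 𝒜 (hmon d) h]
        exact zero_mem _

end Algebra

/-- The counit need not kill H_+, so it is composed with the projection onto H_0 = k, which is
multiplicative. -/
theorem exists_graded_augmentation [Bialgebra k H] (𝒜 : ℕ → Submodule k H) [GradedAlgebra 𝒜]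
    (hconn : 𝒜 0 = Submodule.span k {(1 : H)}) :
    ∃ α : H →ₐ[k] k, (∀ n, 0 < n → ∀ a ∈ 𝒜 n, α a = 0) ∧
      ∀ a, a - algebraMap k H (α a) ∈ positivePart 𝒜 := by
  let α : H →ₐ[k] k :=
    { (Bialgebra.counitAlgHom k H).toRingHom.comp (GradedRing.projZeroRingHom 𝒜) with
      commutes' := fun c => by
        have : (algebraMap k H c) ∈ 𝒜 0 := by
          rw [hconn, Algebra.algebraMap_eq_smul_one]
          exact Submodule.smul_mem _ _ (Submodule.mem_span_singleton_self _)
        change Coalgebra.counit (R := k) (DirectSum.decompose 𝒜 (algebraMap k H c) 0 : H) = c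
        rw [DirectSum.decompose_of_mem_same 𝒜 this, Bialgebra.counit_algebraMap] }
  have hα : ∀ a, α a = Coalgebra.counit (R := k) (GradedAlgebra.proj 𝒜 0 a) := fun a => rfl
  have h0 : ∀ n, 0 < n → ∀ a ∈ 𝒜 n, α a = 0 := fun n hn a ha => by
    rw [hα, GradedAlgebra.proj_of_mem_ne 𝒜 ha hn.ne', map_zero]
  refine ⟨α, h0, ?_⟩
  have h1 : (⊤ : Submodule k H) ≤ (positivePart 𝒜).comap
      (LinearMap.id - (Algebra.linearMap k H).comp α.toLinearMap) := by
    refine (eq_top_of_graded_le 𝒜 fun n a ha => ?_).ge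
    rw [Submodule.mem_comap]
    change a - algebraMap k H (α a) ∈ _
    rcases Nat.eq_zero_or_pos n with rfl | hn
    · rw [hconn, Submodule.mem_span_singleton] at ha
      obtain ⟨c, rfl⟩ := ha
      rw [map_smul, map_one, smul_eq_mul, mul_one, Algebra.algebraMap_eq_smul_one, sub_self]
      exact zero_mem _
    · rw [h0 n hn a ha, map_zero, sub_zero]
      exact mem_positivePart hn ha
  exact fun a => h1 trivial

/-- Expand δ((a - α(a))(b - α(b))) = 0. -/
theorem leibniz_of_vanishing [Algebra k H] {𝒜 : ℕ → Submodule k H} {α : H →ₐ[k] k}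
    (hα : ∀ a, a - algebraMap k H (α a) ∈ positivePart 𝒜) {δ : H →ₗ[k] k} (h1 : δ 1 = 0)
    (hδ : ∀ q ∈ positivePart 𝒜 * positivePart 𝒜, δ q = 0) (a b : H) :
    δ (a * b) = α a * δ b + δ a * α b := by
  have h := hδ _ (Submodule.mul_mem_mul (hα a) (hα b))
  have h2 : (a - algebraMap k H (α a)) * (b - algebraMap k H (α b)) =
      a * b - α a • b - α b • a + (α a * α b) • 1 := by
    simp only [Algebra.smul_def, map_mul]; ring
  rw [h2] at h
  simp only [map_add, map_sub, map_smul, h1, smul_eq_mul] at h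
  linear_combination h

end Graded

/-! ### The main theorem. -/

theorem mainTheorem7 {k : Type u} {H : Type v} [Field k] [CharZero k] [CommRing H] [HopfAlgebra k H]
    (𝒜 : ℕ → Submodule k H) [GradedAlgebra 𝒜]
    (hconn : 𝒜 0 = Submodule.span k {(1 : H)})
    (K : Subalgebra k H) (hK : K.IsHopfSubalgebra)
    (hKgr : DirectSum.SetLike.IsHomogeneous 𝒜 K)
    (hsq : (positivePart 𝒜 * positivePart 𝒜) ⊓ Subalgebra.toSubmodule K =
      positivePart (K.gradedPiece 𝒜) * positivePart (K.gradedPiece 𝒜)) :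
    ∃ (σ : Type v) (w : σ → ℕ) (e : MvPolynomial σ K ≃ₐ[K] H),
      (∀ i, 0 < w i) ∧
      ∀ n : ℕ, (K.polynomialPiece 𝒜 w n).map
        ((e.toAlgHom.restrictScalars k).toLinearMap) = 𝒜 n := by
  obtain ⟨ι, deg, x, S, δ, hdeg, hx, hxK, hδ1, hδQ, hself, hne, hgenH, hgenK⟩ :=
    exists_homogeneous_adapted_family 𝒜 K
  obtain ⟨α, hα0, hα⟩ := exists_graded_augmentation 𝒜 hconn
  choose D hD using fun i => HopfAlgebra.exists_derivation_of_pointDerivation α (δ i)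
    (leibniz_of_vanishing hα (hδ1 i) (hδQ i))
  have hzero : ∀ B : Subalgebra k H, 𝒜 0 ≤ Subalgebra.toSubmodule B := fun B => by
    rw [hconn, Submodule.span_singleton_le_iff_mem]
    exact B.one_mem
  have hspan : ∀ (B : Subalgebra k H) (T : Set ι) (n : ℕ), (∀ i ∈ T, x i ∈ B) →
      (∀ i ∈ T, deg i = n) →
      Submodule.span k (x '' T) ≤ Subalgebra.toSubmodule B ⊓ 𝒜 n := fun B T n hB hn => by
    rw [Submodule.span_le]
    rintro _ ⟨i, hi, rfl⟩
    exact ⟨hB i hi, hn i hi ▸ hx i⟩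
  have htop : Algebra.adjoin k (Set.range x) = ⊤ := by
    rw [← Algebra.toSubmodule_eq_top]
    refine eq_top_of_graded_le 𝒜 (le_of_le_sup_positivePart_mul 𝒜 (fun _ => le_rfl) _ (hzero _) ?_)
    exact fun n => (hgenH n).trans (sup_le_sup_right (hspan _ _ _
      (fun i _ => Algebra.subset_adjoin (Set.mem_range_self i)) (fun i hi => hi)) _)
  have hKeq : Algebra.adjoin k (x '' S) = K := by
    apply le_antisymm
    · rw [Algebra.adjoin_le_iff]
      rintro _ ⟨i, hi, rfl⟩
      exact hxK i hi
    · suffices h : Subalgebra.toSubmodule K ≤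
          Subalgebra.toSubmodule (Algebra.adjoin k (x '' S)) from fun a ha => h ha
      refine Subalgebra.toSubmodule_le_of_gradedPiece_le 𝒜 hKgr
        (le_of_le_sup_positivePart_mul 𝒜 (fun _ => inf_le_right) _
          (inf_le_right.trans (hzero _)) fun n a ha => ?_)
      obtain ⟨r, hr, q, hq, rfl⟩ := Submodule.mem_sup.mp (hgenK n ha)
      refine Submodule.add_mem_sup (hspan _ _ _
        (fun i hi => Algebra.subset_adjoin (Set.mem_image_of_mem x hi.1))
        (fun i hi => hi.2) hr) (hsq.le ⟨hq, ?_⟩)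
      -- The decomposable part q is the difference of two elements of K, so `hsq` puts it in (K_+)².
      have hrK := (hspan K _ _ (fun i hi => hxK i hi.1) (fun i hi => hi.2) hr).1
      have := sub_mem ha.1 hrK
      rwa [add_sub_cancel_left] at this
  have hind : AlgebraicIndependent k x := by
    refine algebraicIndependent_of_dual_derivations α x (fun i => hα0 _ (hdeg i) _ (hx i)) ?_ D
      (fun i => by rw [hD, hself]) (fun i j hij => by rw [hD, hne i j hij])
    rw [← AlgHom.range_eq_top, ← Algebra.adjoin_range_eq_range_aeval, htop]
  have hindK : AlgebraicIndependent K (fun i : ↥Sᶜ => x i) := by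
    have := ((AlgebraicIndependent.iff_adjoin_image S).mp hind).2
    rwa [hKeq] at this
  have hsurj : Function.Surjective
      (MvPolynomial.aeval (fun i : ↥Sᶜ => x i) : MvPolynomial ↥Sᶜ K →ₐ[K] H) := by
    rw [← AlgHom.range_eq_top, eq_top_iff]
    have h : Algebra.adjoin k (Set.range x) ≤ ((MvPolynomial.aeval (fun i : ↥Sᶜ => x i) :
        MvPolynomial ↥Sᶜ K →ₐ[K] H).restrictScalars k).range := by
      rw [Algebra.adjoin_le_iff]
      rintro _ ⟨i, rfl⟩
      by_cases hi : i ∈ S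
      · exact ⟨MvPolynomial.C ⟨x i, hxK i hi⟩, by simp⟩
      · exact ⟨MvPolynomial.X ⟨i, hi⟩, by simp⟩
    rw [htop] at h
    exact fun a _ => h trivial
  refine ⟨↥Sᶜ, fun i => deg i, AlgEquiv.ofBijective _ ⟨hindK, hsurj⟩, fun i => hdeg i, fun n => ?_⟩
  exact Subalgebra.map_polynomialPiece 𝒜 hKgr (x := fun i : ↥Sᶜ => x i) (fun i => hx i) hsurj n
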